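/- Let $\mathcal{C}$ be a small preadditive category, i.e. a small category whose Hom-sets are abelian groups with biadditive composition (for instance any small additive category). Let $\mathrm{Mod}\,\mathcal{C}$ be the category of $\mathcal{C}$-modules, i.e. of additive functors $\mathcal{C}^{\mathrm{op}} \to \mathrm{Ab}$. For a $\mathcal{C}$-module $M$ put $|M| = \sum_{X \in \mathcal{S}} |M(X)|$, where $\mathcal{S}$ is a skeleton of $\mathcal{C}$. For an infinite regular cardinal $\alpha$, a morphism of $\mathrm{Mod}\,\mathcal{C}$ is called an $\alpha$-pure monomorphism if it is an $\alpha$-filtered colimit of split monomorphisms (i.e. it is the morphism induced on colimits by a natural transformation, all of whose components are split monomorphisms, between two diagrams in $\mathrm{Mod}\,\mathcal{C}$ indexed by the same small $\alpha$-filtered category); a submodule $K$ of $M$ is called an $\alpha$-pure subobject of $M$ if the inclusion $K \to M$ is an $\alpha$-pure monomorphism. For every infinite regular cardinal $\alpha$ and every cardinal $\lambda$ there is a cardinal $\kappa$ with the following property: for every $\mathcal{C}$-module $M$ with $|M| \geq \kappa$ and every submodule $L$ of $M$ with $|M/L| \leq \lambda$, the submodule $L$ contains a nonzero $\alpha$-pure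 subobject of $M$. -/

import Mathlib

open CategoryTheory Limits Opposite

universe u

/-- The category `Mod C` of `C`-modules over a small preadditive category `C`: additive functors
`Cᵒᵖ ⥤ Ab` and natural transformations between them. -/
abbrev CMod (C : Type u) [SmallCategory C] [Preadditive C] :=
  Cᵒᵖ ⥤+ AddCommGrpCat.{u}

namespace CMod

variable {C : Type u} [SmallCategory C] [Preadditive C]

/-- The cardinality `|M|`: the sum of the cardinalities of `M(X)`, with `X` running through a
skeleton of `C`. -/
noncomputable def card (M : CMod C) : Cardinal.{u} :=
  Cardinal.sum fun X : Skeleton C => Cardinal.mk (M.obj.obj (op ((fromSkeleton C).obj X)))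

/-- A submodule of `M`: a family of subgroups of the groups `M(X)` that is stable under the action
of the morphisms of `C`. -/
@[ext]
structure Sub (M : CMod C) where
  /-- the subgroup of `M(X)` -/
  carrier (X : Cᵒᵖ) : AddSubgroup (M.obj.obj X)
  map_mem {X Y : Cᵒᵖ} (f : X ⟶ Y) {m : M.obj.obj X} (hm : m ∈ carrier X) :
    (M.obj.map f).hom m ∈ carrier Y

namespace Sub

variable {M : CMod C}

/-- Submodules are ordered by objectwise inclusion. -/
instance : PartialOrder (Sub M) :=
  PartialOrder.lift Sub.carrier fun _ _ h => Sub.ext h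

/-- The zero submodule. -/
instance : Bot (Sub M) where
  bot :=
    { carrier := fun _ => ⊥
      map_mem := by
        intro X Y f m hm
        rw [AddSubgroup.mem_bot] at hm ⊢
        rw [hm, map_zero] }

/-- A submodule regarded as a `C`-module. -/
def toCMod (L : Sub M) : CMod C where
  obj :=
    { obj := fun X => AddCommGrpCat.of (L.carrier X)
      map := fun {X Y} f => AddCommGrpCat.ofHom
        (((M.obj.map f).hom.comp (L.carrier X).subtype).codRestrict (L.carrier Y)
          fun m => L.map_mem f m.2)
      map_id := by
        intro X
        ext m
        simp
      map_comp := by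
        intro X Y Z f g
        ext m
        simp }
  property := by
    refine ⟨?_⟩
    intro X Y f g
    ext m
    simp [Functor.map_add]

/-- The inclusion of a submodule. -/
def ι (L : Sub M) : L.toCMod ⟶ M where
  hom :=
    { app := fun X => AddCommGrpCat.ofHom (L.carrier X).subtype
      naturality := by
        intro X Y f
        ext m
        rfl }

/-- The quotient module `M / L`, given by `(M / L)(X) = M(X) / L(X)`. -/
def quotient (L : Sub M) : CMod C where
  obj :=
    { obj := fun X => AddCommGrpCat.of (M.obj.obj X ⧸ L.carrier X)
      map := fun {X Y} f => AddCommGrpCat.ofHom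
        (QuotientAddGroup.map (L.carrier X) (L.carrier Y) (M.obj.map f).hom
          fun _ hm => L.map_mem f hm)
      map_id := by
        intro X
        ext m
        simp
      map_comp := by
        intro X Y Z f g
        ext m
        simp
        rfl }
  property := by
    refine ⟨?_⟩
    intro X Y f g
    ext m
    simp [Functor.map_add]
    rfl

end Sub

/-- A morphism in `Mod C` is an `α`-pure monomorphism if it is an `α`-filtered colimit of split
monomorphisms: there are a small `α`-filtered category `J` and a natural transformation between two
diagrams `J ⥤ Mod C` whose components are split monomorphisms such that the given morphism is the
induced morphism between their colimits. -/
def IsPureMono (α : Cardinal.{u}) [Fact α.IsRegular] {M N : CMod C} (f : M ⟶ N) : Prop :=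
  ∃ (J : Type u) (_ : SmallCategory J) (_ : IsCardinalFiltered J α),
    MorphismProperty.colimitsOfShape (fun _ _ g => IsSplitMono g) J f

end CMod

/-! Fix subsets N(X) of M(X), the hull, of total size bounded independently of M and L and closed
under copying: a family σ in M indexed by the terms of a fixed language, compatible with the module
operations, has a copy σ' in N that is again compatible, preserves equalities of values and classes
modulo L, and equals σ wherever σ lies in N (`exists_hull_copy`). If M is larger, pick m₀ outside N,
let σ be the values of the terms in m₀, and let K consist of the differences σ(g) - σ'(g). Equal
classes give K ≤ L, and K ≠ 0 because m₀ is not in N while its copy is.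

For purity, the language has, for each small linear system A, operations choosing s in N and w with
k - s = A w whenever such a pair exists. If σ(g) - σ'(g) = A y, a pair exists for k = σ(g), since s
= σ'(g) is allowed. The equality σ(g) = s + A w relates values of terms, so its copy is σ'(g) = s +
A w', where s is kept because it lies in N. Subtracting, w - w' is a solution in K
(`isPureMono_diffSub`).

Such solutions give purity (`Sub.isPureMono_ι`): M is the α-filtered colimit of the quotients of K ⊕
F, with F free, by fewer than α relations, and solving these relations in K gives a retraction onto
K (`isPureMono_comp`). -/

namespace CMod

/-! ### Morphisms, quotients and generated submodules -/

variable {C : Type u} [SmallCategory C] [Preadditive C]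

/-- A morphism of modules, from a family of group homomorphisms that is compatible with the action
of the morphisms of `C`. -/
def mkHom {M N : CMod C} (φ : ∀ X, M.obj.obj X →+ N.obj.obj X)
    (h : ∀ {X Y : Cᵒᵖ} (f : X ⟶ Y) (m : M.obj.obj X),
      φ Y ((M.obj.map f).hom m) = (N.obj.map f).hom (φ X m)) : M ⟶ N where
  hom :=
    { app := fun X => AddCommGrpCat.ofHom (φ X)
      naturality := by
        intro X Y f
        ext m
        exact h f m }

@[simp]
lemma comp_apply {M N P : CMod C} (f : M ⟶ N) (g : N ⟶ P) (X : Cᵒᵖ) (m : M.obj.obj X) :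
    ((f ≫ g).hom.app X).hom m = (g.hom.app X).hom ((f.hom.app X).hom m) := rfl

lemma hom_ext' {M N : CMod C} {f g : M ⟶ N}
    (h : ∀ X (m : M.obj.obj X), (f.hom.app X).hom m = (g.hom.app X).hom m) : f = g := by
  apply InducedCategory.hom_ext
  ext X m
  exact h X m

lemma naturality_apply {M N : CMod C} (f : M ⟶ N) {X Y : Cᵒᵖ} (g : X ⟶ Y) (m : M.obj.obj X) :
    (f.hom.app Y).hom ((M.obj.map g).hom m) = (N.obj.map g).hom ((f.hom.app X).hom m) :=
  ConcreteCategory.congr_hom (f.hom.naturality g) m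

namespace Sub

variable {M : CMod C}

/-- The projection onto the quotient by a submodule. -/
def proj (L : Sub M) : M ⟶ L.quotient :=
  mkHom (M := M) (N := L.quotient) (fun X => QuotientAddGroup.mk' (L.carrier X)) fun _ _ => rfl

lemma proj_surjective (L : Sub M) (X : Cᵒᵖ) : Function.Surjective (L.proj.hom.app X).hom :=
  QuotientAddGroup.mk'_surjective (L.carrier X)

lemma proj_eq_iff (L : Sub M) {X : Cᵒᵖ} {m n : M.obj.obj X} :
    (L.proj.hom.app X).hom m = (L.proj.hom.app X).hom n ↔ m - n ∈ L.carrier X :=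
  QuotientAddGroup.eq_iff_sub_mem

/-- The universal property of the quotient by a submodule. -/
def desc (L : Sub M) {P : CMod C} (f : M ⟶ P)
    (h : ∀ X, ∀ m ∈ L.carrier X, (f.hom.app X).hom m = 0) : L.quotient ⟶ P :=
  mkHom (M := L.quotient) (N := P)
    (fun X => QuotientAddGroup.lift (L.carrier X) (f.hom.app X).hom (h X)) (by
      intro X Y g m
      obtain ⟨m, rfl⟩ := L.proj_surjective X m
      exact naturality_apply f g m)

@[simp]
lemma proj_desc (L : Sub M) {P : CMod C} (f : M ⟶ P) (h) : L.proj ≫ L.desc f h = f := rfl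

lemma quotient_hom_ext (L : Sub M) {P : CMod C} {f g : L.quotient ⟶ P}
    (h : L.proj ≫ f = L.proj ≫ g) : f = g := by
  refine hom_ext' fun X m => ?_
  obtain ⟨m, rfl⟩ := L.proj_surjective X m
  rw [← comp_apply, h, comp_apply]

/-- The submodule generated by a set of elements. -/
def gen (R : Set (Σ X, M.obj.obj X)) : Sub M where
  carrier Y := AddSubgroup.closure
    {n | ∃ r ∈ R, ∃ f : r.1 ⟶ Y, n = (M.obj.map f).hom r.2}
  map_mem {X Y} f m hm := by
    induction hm using AddSubgroup.closure_induction with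
    | mem x hx =>
      obtain ⟨r, hr, g, rfl⟩ := hx
      exact AddSubgroup.subset_closure ⟨r, hr, g ≫ f, by simp⟩
    | zero => rw [map_zero]; exact zero_mem _
    | add x y _ _ hx hy => rw [map_add]; exact add_mem hx hy
    | neg x _ hx => rw [map_neg]; exact neg_mem hx

lemma mem_gen {R : Set (Σ X, M.obj.obj X)} {r : Σ X, M.obj.obj X} (hr : r ∈ R) :
    r.2 ∈ (gen R).carrier r.1 :=
  AddSubgroup.subset_closure ⟨r, hr, 𝟙 _, by simp⟩

lemma gen_mono {R R' : Set (Σ X, M.obj.obj X)} (h : R ⊆ R') (X : Cᵒᵖ) :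
    (gen R).carrier X ≤ (gen R').carrier X :=
  AddSubgroup.closure_mono fun _ ⟨r, hr, f, e⟩ => ⟨r, h hr, f, e⟩

lemma map_eq_zero_of_mem_gen {P : CMod C} (f : M ⟶ P) {R : Set (Σ X, M.obj.obj X)}
    (h : ∀ r ∈ R, (f.hom.app r.1).hom r.2 = 0) (X : Cᵒᵖ) (m : M.obj.obj X)
    (hm : m ∈ (gen R).carrier X) : (f.hom.app X).hom m = 0 := by
  induction hm using AddSubgroup.closure_induction with
  | mem x hx =>
    obtain ⟨r, hr, g, rfl⟩ := hx
    rw [naturality_apply, h r hr, map_zero]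
  | zero => rw [map_zero]
  | add x y _ _ hx hy => rw [map_add, hx, hy, add_zero]
  | neg x _ hx => rw [map_neg, hx, neg_zero]

end Sub

/-! ### Quotients as α-filtered colimits, and a criterion for purity -/

section Presentation

variable (α : Cardinal.{u}) {D M : CMod C} (p : D ⟶ M)

/-- The sets of fewer than `α` elements of the kernel of `p`. -/
abbrev SmallRel : Type u :=
  {R : Set (Σ X, D.obj.obj X) // (∀ r ∈ R, (p.hom.app r.1).hom r.2 = 0) ∧ Cardinal.mk R < α}

instance [hα : Fact α.IsRegular] : IsCardinalFiltered (SmallRel α p) α :=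
  isCardinalFiltered_preorder _ _ fun K s hK =>
    ⟨⟨⋃ k, (s k).1, by
      intro r hr
      obtain ⟨k, hk⟩ := Set.mem_iUnion.1 hr
      exact (s k).2.1 r hk, by
      -- Regularity of `α` keeps this union of fewer than `α` small sets small.
      refine (Cardinal.mk_iUnion_le_sum_mk).trans_lt ?_
      exact Cardinal.sum_lt_of_isRegular hα.out hK fun k => (s k).2.2⟩,
     fun k => Set.subset_iUnion (fun k => (s k).1) k⟩

/-- The diagram of the quotients of `D` by fewer than `α` elements of the kernel of `p`. -/
def relDiagram : SmallRel α p ⥤ CMod C where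
  obj R := (Sub.gen R.1).quotient
  map {R R'} h := (Sub.gen R.1).desc (Sub.gen R'.1).proj fun X m hm => by
    have := (Sub.proj_eq_iff (Sub.gen R'.1) (m := m) (n := 0)).2
      (by rw [sub_zero]; exact Sub.gen_mono (leOfHom h) X hm)
    rw [this, map_zero]
  map_id R := Sub.quotient_hom_ext _ (by rw [Sub.proj_desc, Category.comp_id])
  map_comp f g := Sub.quotient_hom_ext _ (by
    rw [Sub.proj_desc, ← Category.assoc, Sub.proj_desc, Sub.proj_desc])

variable {α p} in
/-- The projection of `D` onto a term of the diagram of quotients. -/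
def relProj (R : SmallRel α p) : D ⟶ (relDiagram α p).obj R :=
  (Sub.gen R.1).proj

variable {α p} in
lemma relProj_map {R R' : SmallRel α p} (f : R ⟶ R') :
    relProj R ≫ (relDiagram α p).map f = relProj R' := rfl

variable {α p} in
lemma rel_hom_ext {R : SmallRel α p} {P : CMod C} {f g : (relDiagram α p).obj R ⟶ P}
    (h : relProj R ≫ f = relProj R ≫ g) : f = g :=
  Sub.quotient_hom_ext _ h

variable {α p} in
/-- The morphism from a term of the diagram of quotients given by a morphism that vanishes on the
relations. -/
def relDesc (R : SmallRel α p) {P : CMod C} (f : D ⟶ P)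
    (hf : ∀ r ∈ R.1, (f.hom.app r.1).hom r.2 = 0) : (relDiagram α p).obj R ⟶ P :=
  (Sub.gen R.1).desc f (Sub.map_eq_zero_of_mem_gen f hf)

variable {α p} in
lemma relProj_desc (R : SmallRel α p) {P : CMod C} (f : D ⟶ P) (hf) :
    relProj R ≫ relDesc R f hf = f := rfl

variable {α p} in
lemma relProj_eq_zero (R : SmallRel α p) {X : Cᵒᵖ} {d : D.obj.obj X}
    (hd : (⟨X, d⟩ : Σ X, D.obj.obj X) ∈ R.1) : ((relProj R).hom.app X).hom d = 0 := by
  have := (Sub.proj_eq_iff (Sub.gen R.1) (m := d) (n := 0)).2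
    (by rw [sub_zero]; exact Sub.mem_gen hd)
  rw [map_zero] at this
  exact this

/-- The cocone of the quotients of `D` over `M`. -/
def relCocone : Cocone (relDiagram α p) where
  pt := M
  ι :=
    { app R := relDesc R p R.2.1
      naturality R R' h := rel_hom_ext (by
        rw [← Category.assoc, relProj_map, relProj_desc]
        exact (relProj_desc R p R.2.1).symm) }

variable {α p} in
lemma relProj_comp_ι (s : Cocone (relDiagram α p)) {R R' : SmallRel α p} (h : R ≤ R') :
    relProj R ≫ s.ι.app R = relProj R' ≫ s.ι.app R' := by
  rw [← s.w (homOfLE h), ← Category.assoc, relProj_map]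

/-- A morphism that vanishes on the kernel of an epimorphism factors through it. -/
noncomputable def descOfSurjective {p : D ⟶ M} (hp : ∀ X, Function.Surjective (p.hom.app X).hom)
    {P : CMod C} (g : D ⟶ P)
    (hg : ∀ X d, (p.hom.app X).hom d = 0 → (g.hom.app X).hom d = 0) : M ⟶ P :=
  mkHom (fun X => (p.hom.app X).hom.liftOfSurjective (hp X) ⟨(g.hom.app X).hom, hg X⟩) (by
    intro X Y f m
    obtain ⟨d, rfl⟩ := hp X m
    rw [← naturality_apply]
    erw [AddMonoidHom.liftOfRightInverse_comp_apply, AddMonoidHom.liftOfRightInverse_comp_apply]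
    exact naturality_apply g f d)

lemma comp_descOfSurjective {p : D ⟶ M} (hp : ∀ X, Function.Surjective (p.hom.app X).hom)
    {P : CMod C} (g : D ⟶ P) (hg) : p ≫ descOfSurjective hp g hg = g :=
  hom_ext' fun X d => AddMonoidHom.liftOfRightInverse_comp_apply (p.hom.app X).hom _
    (Function.rightInverse_surjInv (hp X)) ⟨(g.hom.app X).hom, hg X⟩ d

lemma hom_ext_of_surjective {p : D ⟶ M} (hp : ∀ X, Function.Surjective (p.hom.app X).hom)
    {P : CMod C} {f g : M ⟶ P} (h : p ≫ f = p ≫ g) : f = g := by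
  refine hom_ext' fun X m => ?_
  obtain ⟨m, rfl⟩ := hp X m
  rw [← comp_apply, h, comp_apply]

/-- The empty set of relations. -/
def emptyRel [hα : Fact α.IsRegular] : SmallRel α p :=
  ⟨∅, by simp, by simpa using hα.out.pos⟩

/-- The legs of a cocone agree after restriction to `D`, so one may pass to the stage whose only
relation is `d`. -/
lemma relProj_comp_ι_eq_zero [hα : Fact α.IsRegular] (s : Cocone (relDiagram α p)) (X : Cᵒᵖ)
    (d : D.obj.obj X) (hd : (p.hom.app X).hom d = 0) :
    ((relProj (emptyRel α p) ≫ s.ι.app (emptyRel α p)).hom.app X).hom d = 0 := by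
  let R : SmallRel α p := ⟨{⟨X, d⟩}, by
    intro r hr
    rw [Set.mem_singleton_iff] at hr
    subst hr
    exact hd, by simpa using Cardinal.one_lt_aleph0.trans_le hα.out.aleph0_le⟩
  have hle : emptyRel α p ≤ R := Set.empty_subset R.1
  rw [relProj_comp_ι s hle]
  rw [comp_apply, relProj_eq_zero R (Set.mem_singleton _), map_zero]

/-- The target of an epimorphism is the colimit of the quotients of its source by fewer than `α`
elements of the kernel. -/
noncomputable def relCoconeIsColimit [Fact α.IsRegular]
    (hp : ∀ X, Function.Surjective (p.hom.app X).hom) : IsColimit (relCocone α p) where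
  desc s := descOfSurjective hp _ (relProj_comp_ι_eq_zero α p s)
  fac s R := rel_hom_ext (by
    rw [← relProj_comp_ι s (show emptyRel α p ≤ R from Set.empty_subset R.1)]
    exact comp_descOfSurjective hp _ (relProj_comp_ι_eq_zero α p s))
  uniq s m hm := hom_ext_of_surjective hp (by
    rw [comp_descOfSurjective, ← hm]
    rfl)

/-- A criterion for purity: let `p : D ⟶ M` be an epimorphism, and suppose that for every set of
fewer than `α` elements of its kernel the morphism `i : K ⟶ D` has a retraction that vanishes on
this set. Then `i ≫ p` is an `α`-pure monomorphism. -/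
theorem isPureMono_comp [Fact α.IsRegular] {K : CMod C} (i : K ⟶ D)
    (hp : ∀ X, Function.Surjective (p.hom.app X).hom)
    (h : ∀ R : SmallRel α p, ∃ r : D ⟶ K, i ≫ r = 𝟙 K ∧
      ∀ d ∈ R.1, (r.hom.app d.1).hom d.2 = 0) :
    IsPureMono α (i ≫ p) := by
  -- Connectedness is what makes `K` the colimit of the constant diagram `K`.
  have : IsFiltered (SmallRel α p) := isFiltered_of_isCardinalFiltered _ α
  have : IsConnected (SmallRel α p) := IsFiltered.isConnected _
  refine ⟨SmallRel α p, inferInstance, inferInstance, ?_⟩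
  refine MorphismProperty.colimitsOfShape.mk' _ (relDiagram α p) _ (relCocone α p)
    (isColimitConstCocone (SmallRel α p) K) (relCoconeIsColimit α p hp)
    { app R := i ≫ relProj R
      naturality R R' f := by
        rw [Category.assoc, relProj_map]
        exact Category.id_comp _ } ?_ _ ?_
  · intro R
    obtain ⟨r, hr, hR⟩ := h R
    exact ⟨⟨⟨relDesc R r hR, by rw [Category.assoc, relProj_desc]; exact hr⟩⟩⟩
  · intro R
    exact Category.id_comp _

end Presentation

/-! ### Linear combinations and free modules -/

/-- The action of morphisms on an element of a module. -/
def act (M : CMod C) {X : Cᵒᵖ} (m : M.obj.obj X) (Y : Cᵒᵖ) : (X ⟶ Y) →+ M.obj.obj Y where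
  toFun f := (M.obj.map f).hom m
  map_zero' := by rw [Functor.map_zero]; rfl
  map_add' f g := by rw [Functor.map_add]; rfl

open Classical in
/-- The value of a linear combination at a family of elements of a module. -/
noncomputable def eval (M : CMod C) {I : Type u} {x : I → Cᵒᵖ} (y : ∀ b, M.obj.obj (x b))
    (Y : Cᵒᵖ) : (Π₀ b, (x b ⟶ Y)) →+ M.obj.obj Y :=
  DFinsupp.sumAddHom fun b => M.act (y b) Y

@[simp]
lemma eval_single (M : CMod C) {I : Type u} [DecidableEq I] {x : I → Cᵒᵖ} (y : ∀ b, M.obj.obj (x b))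
    (Y : Cᵒᵖ) (b : I) (f : x b ⟶ Y) :
    M.eval y Y (DFinsupp.single b f) = (M.obj.map f).hom (y b) := by
  change _ = M.act (y b) Y f
  rw [eval]
  convert DFinsupp.sumAddHom_single (fun b => M.act (y b) Y) b f

/-- The action of a morphism on linear combinations. -/
noncomputable def combMap {I : Type u} (x : I → Cᵒᵖ) {Y Z : Cᵒᵖ} (g : Y ⟶ Z) :
    (Π₀ b, (x b ⟶ Y)) →+ (Π₀ b, (x b ⟶ Z)) :=
  DFinsupp.mapRange.addMonoidHom fun b => Preadditive.rightComp (x b) g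

lemma eval_combMap (M : CMod C) {I : Type u} {x : I → Cᵒᵖ} (y : ∀ b, M.obj.obj (x b))
    {Y Z : Cᵒᵖ} (g : Y ⟶ Z) (c : Π₀ b, (x b ⟶ Y)) :
    M.eval y Z (combMap x g c) = (M.obj.map g).hom (M.eval y Y c) := by
  classical
  suffices (M.eval y Z).comp (combMap x g) = (M.obj.map g).hom.comp (M.eval y Y) from
    DFunLike.congr_fun this c
  refine DFinsupp.addHom_ext fun b f => ?_
  simp [combMap, Preadditive.rightComp]

lemma map_eval {M N : CMod C} (φ : M ⟶ N) {I : Type u} {x : I → Cᵒᵖ}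
    (y : ∀ b, M.obj.obj (x b)) (Y : Cᵒᵖ) (c : Π₀ b, (x b ⟶ Y)) :
    (φ.hom.app Y).hom (M.eval y Y c) = N.eval (fun b => (φ.hom.app (x b)).hom (y b)) Y c := by
  classical
  suffices (φ.hom.app Y).hom.comp (M.eval y Y) =
      N.eval (fun b => (φ.hom.app (x b)).hom (y b)) Y from DFunLike.congr_fun this c
  refine DFinsupp.addHom_ext fun b f => ?_
  simp

lemma eval_sub (M : CMod C) {I : Type u} {x : I → Cᵒᵖ} (y z : ∀ b, M.obj.obj (x b))
    (Y : Cᵒᵖ) (c : Π₀ b, (x b ⟶ Y)) :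
    M.eval (fun b => y b - z b) Y c = M.eval y Y c - M.eval z Y c := by
  classical
  suffices M.eval (fun b => y b - z b) Y = M.eval y Y - M.eval z Y from DFunLike.congr_fun this c
  refine DFinsupp.addHom_ext fun b f => ?_
  simp

/-- This reindexes an equation in the elements of `M` by a set of variables that does not depend on
`M`. -/
lemma eval_comapDomain (M : CMod C) {I J : Type u} {x : I → Cᵒᵖ} (y : ∀ b, M.obj.obj (x b))
    {e : J → I} (he : Function.Injective e) (Y : Cᵒᵖ) (c : Π₀ b, (x b ⟶ Y))
    (hc : ∀ b, c b ≠ 0 → b ∈ Set.range e) :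
    M.eval (fun b => y (e b)) Y (c.comapDomain e he) = M.eval y Y c := by
  classical
  induction c using DFinsupp.induction with
  | h0 => rw [DFinsupp.comapDomain_zero, map_zero, map_zero]
  | ha b f c hb hf ih =>
    obtain ⟨j, rfl⟩ := hc b (by simpa [hb] using hf)
    rw [DFinsupp.comapDomain_add, map_add, map_add, ih, DFinsupp.comapDomain_single, eval_single,
      eval_single]
    intro b' hb'
    refine hc b' ?_
    rcases eq_or_ne (e j) b' with rfl | h
    · exact absurd hb hb'
    · simpa [DFinsupp.single_eq_of_ne h.symm] using hb'

/-- The direct sum of a module and the free module with generators of degrees `x b`. -/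
noncomputable def adjoin (K : CMod C) {I : Type u} (x : I → Cᵒᵖ) : CMod C where
  obj :=
    { obj := fun Y => AddCommGrpCat.of (K.obj.obj Y × Π₀ b, (x b ⟶ Y))
      map := fun g => AddCommGrpCat.ofHom ((K.obj.map g).hom.prodMap (combMap x g))
      map_id := fun Y => by
        ext ⟨k, c⟩
        · exact ConcreteCategory.congr_hom (K.obj.map_id Y) k
        · exact Category.comp_id (c _)
      map_comp := fun g h => by
        ext ⟨k, c⟩
        · exact ConcreteCategory.congr_hom (K.obj.map_comp g h) k
        · exact (Category.assoc (c _) g h).symm }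
  property := ⟨by
    intro Y Z g h
    ext ⟨k, c⟩
    · exact ConcreteCategory.congr_hom (K.obj.map_add (f := g) (g := h)) k
    · exact Preadditive.comp_add _ _ _ (c _) g h⟩

/-- The inclusion of a module in its sum with a free module. -/
noncomputable def toAdjoin (K : CMod C) {I : Type u} (x : I → Cᵒᵖ) : K ⟶ K.adjoin x :=
  mkHom (M := K) (N := K.adjoin x) (fun Y => AddMonoidHom.inl (K.obj.obj Y) (Π₀ b, (x b ⟶ Y))) (by
    intro Y Z g k
    exact Prod.ext rfl (map_zero (combMap x g)).symm)

/-- The morphism from the sum of a module and a free module given by its restrictions. -/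
noncomputable def ofAdjoin {K N : CMod C} {I : Type u} {x : I → Cᵒᵖ} (f : K ⟶ N)
    (y : ∀ b, N.obj.obj (x b)) : K.adjoin x ⟶ N :=
  mkHom (M := K.adjoin x) (N := N) (fun Y => (f.hom.app Y).hom.coprod (N.eval y Y)) (by
    rintro Y Z g ⟨k, c⟩
    change (f.hom.app Z).hom ((K.obj.map g).hom k) + N.eval y Z (combMap x g c) =
      (N.obj.map g).hom ((f.hom.app Y).hom k + N.eval y Y c)
    rw [naturality_apply, eval_combMap, map_add])

lemma ofAdjoin_apply {K N : CMod C} {I : Type u} {x : I → Cᵒᵖ} (f : K ⟶ N)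
    (y : ∀ b, N.obj.obj (x b)) (Y : Cᵒᵖ) (d : (K.adjoin x).obj.obj Y) :
    ((ofAdjoin f y).hom.app Y).hom d = (f.hom.app Y).hom d.1 + N.eval y Y d.2 := rfl

lemma toAdjoin_ofAdjoin {K N : CMod C} {I : Type u} {x : I → Cᵒᵖ} (f : K ⟶ N)
    (y : ∀ b, N.obj.obj (x b)) : K.toAdjoin x ≫ ofAdjoin f y = f :=
  hom_ext' fun Y k => by
    rw [comp_apply, ofAdjoin_apply]
    exact (congrArg _ (map_zero (N.eval y Y))).trans (add_zero _)

/-! ### Purity through linear systems -/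

variable (C) in
/-- A system of at most `α` linear combinations in at most `α` variables. -/
structure LinSystem (α : Cardinal.{u}) : Type u where
  /-- the set of variables -/
  vars : Set α.out
  /-- the degrees of the variables -/
  x : vars → Cᵒᵖ
  /-- the set of equations -/
  eqs : Set α.out
  /-- the degrees of the equations -/
  Y : eqs → Cᵒᵖ
  /-- the coefficients -/
  coeff (p : eqs) : Π₀ b, (x b ⟶ Y p)

/-- A submodule `K` of `M` is `α`-pure if every system of at most `α` linear equations in at most
`α` variables with right hand sides in `K` that has a solution in `M` has a solution in `K`. -/
theorem Sub.isPureMono_ι {α : Cardinal.{u}} [hα : Fact α.IsRegular] {M : CMod C} (K : Sub M)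
    (hK : ∀ (t : LinSystem C α) (k : ∀ p, M.obj.obj (t.Y p)) (y : ∀ b, M.obj.obj (t.x b)),
      (∀ p, k p ∈ K.carrier (t.Y p)) → (∀ p, k p = M.eval y _ (t.coeff p)) →
        ∃ y' : ∀ b, M.obj.obj (t.x b), (∀ b, y' b ∈ K.carrier (t.x b)) ∧
          ∀ p, k p = M.eval y' _ (t.coeff p)) :
    IsPureMono α K.ι := by
  classical
  let I : Type u := Σ X, M.obj.obj X
  let x : I → Cᵒᵖ := Sigma.fst
  let y : ∀ b, M.obj.obj (x b) := Sigma.snd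
  let p : K.toCMod.adjoin x ⟶ M := ofAdjoin K.ι y
  have hip : K.toCMod.toAdjoin x ≫ p = K.ι := toAdjoin_ofAdjoin _ _
  rw [← hip]
  refine isPureMono_comp α p _ ?_ ?_
  · intro X m
    refine ⟨((0 : K.toCMod.obj.obj X), DFinsupp.single (⟨X, m⟩ : I) (𝟙 X)), ?_⟩
    change (K.ι.hom.app X).hom 0 + M.eval y X (DFinsupp.single (⟨X, m⟩ : I) (𝟙 X)) = m
    rw [map_zero, eval_single, zero_add]
    exact ConcreteCategory.congr_hom (M.obj.map_id X) m
  · rintro ⟨R, hR, hcard⟩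
    -- The variables that occur in `R`: at most `α` many, since each relation has finite support.
    let Γ : Set I := ⋃ r : R, {b | r.1.2.2 b ≠ 0}
    have hΓ : Cardinal.mk Γ ≤ Cardinal.mk α.out := by
      rw [Cardinal.mk_out]
      refine (Cardinal.mk_iUnion_le _).trans ?_
      refine (mul_le_mul' hcard.le (ciSup_le' (a := α) fun r => ?_)).trans
        (Cardinal.mul_eq_self hα.out.aleph0_le).le
      exact (Set.Finite.lt_aleph0 (DFinsupp.finite_support _)).le.trans hα.out.aleph0_le
    obtain ⟨V, hV⟩ := Cardinal.le_mk_iff_exists_set.1 hΓ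
    obtain ⟨E, hE⟩ := Cardinal.le_mk_iff_exists_set.1 (hcard.le.trans (Cardinal.mk_out α).ge)
    obtain ⟨e⟩ := Cardinal.eq.1 hV
    obtain ⟨ρ⟩ := Cardinal.eq.1 hE
    let e' : V → I := fun b => (e b).1
    have he' : Function.Injective e' := Subtype.val_injective.comp e.injective
    have hrange (r : R) (b : I) (hb : r.1.2.2 b ≠ 0) : b ∈ Set.range e' :=
      ⟨e.symm ⟨b, Set.mem_iUnion.2 ⟨r, hb⟩⟩, by simp [e']⟩
    let t : LinSystem C α :=
      { vars := V
        x := fun b => x (e' b)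
        eqs := E
        Y := fun q => (ρ q).1.1
        coeff := fun q => (ρ q).1.2.2.comapDomain e' he' }
    -- A relation `(k, c)` lies in the kernel when `k` plus the value of `c` is zero, whence the
    -- sign.
    obtain ⟨y', hy', hsol⟩ := hK t (fun q => -((ρ q).1.2.1.1)) (fun b => y (e' b))
      (fun q => neg_mem (ρ q).1.2.1.2) (fun q => by
        have h0 := hR _ (ρ q).2
        rw [ofAdjoin_apply] at h0
        refine (neg_eq_of_add_eq_zero_right h0).trans ?_
        exact (M.eval_comapDomain y he' _ _ (hrange (ρ q))).symm)
    -- Variables that do not occur in `R` may go anywhere, so they go to zero.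
    let z : ∀ b, K.toCMod.obj.obj (x b) := fun b =>
      if h : b ∈ Set.range e' then h.choose_spec ▸ ⟨y' h.choose, hy' _⟩ else 0
    have hz (b : V) : z (e' b) = ⟨y' b, hy' b⟩ := by
      have h : e' b ∈ Set.range e' := ⟨b, rfl⟩
      have key : ∀ (j : V) (hj : e' j = e' b),
          (hj ▸ (⟨y' j, hy' j⟩ : K.carrier (x (e' j))) : K.carrier (x (e' b))) =
            ⟨y' b, hy' b⟩ := by
        intro j hj
        obtain rfl := he' hj
        rfl
      exact (dif_pos h).trans (key _ h.choose_spec)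
    refine ⟨ofAdjoin (𝟙 _) z, toAdjoin_ofAdjoin _ _, fun r hr => ?_⟩
    obtain ⟨q, hq⟩ := ρ.surjective ⟨r, hr⟩
    suffices (((ofAdjoin (𝟙 K.toCMod) z).hom.app (ρ q).1.1).hom (ρ q).1.2) = 0 by
      rwa [hq] at this
    rw [ofAdjoin_apply, ← eval_comapDomain _ z he' _ _ (hrange (ρ q))]
    have h := map_eval K.ι (fun b => z (e' b)) _ (t.coeff q)
    have hzy : (fun b => (K.ι.hom.app (t.x b)).hom (z (e' b))) = y' :=
      funext fun b => congrArg Subtype.val (hz b)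
    rw [hzy, ← hsol] at h
    refine (congrArg _ (Subtype.ext h : _ = -(ρ q).1.2.1)).trans ?_
    exact add_neg_cancel _

/-! ### The language of terms -/

variable (C) in
/-- Terms built from one constant in each degree by the module operations, together with two
operations for each linear system: a choice of a translation of the right hand sides, and a choice
of a solution of the translated system. -/
inductive Term (α : Cardinal.{u}) : Cᵒᵖ → Type u
  | const (X : Cᵒᵖ) : Term α X
  | zero (X : Cᵒᵖ) : Term α X
  | add {X : Cᵒᵖ} (g h : Term α X) : Term α X
  | neg {X : Cᵒᵖ} (g : Term α X) : Term α X
  | map {X Y : Cᵒᵖ} (f : X ⟶ Y) (g : Term α X) : Term α Y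
  | shift (t : LinSystem C α) (k : ∀ p, Term α (t.Y p)) (p : t.eqs) : Term α (t.Y p)
  | sol (t : LinSystem C α) (k : ∀ p, Term α (t.Y p)) (b : t.vars) : Term α (t.x b)

/-- Up to a translation of the right hand sides by elements of `N`, the linear system `t` with
right hand sides `k` has the solution `s.2`. -/
def IsShiftedSol {α : Cardinal.{u}} {M : CMod C} (N : ∀ X, Set (M.obj.obj X)) (t : LinSystem C α)
    (k : ∀ p, M.obj.obj (t.Y p))
    (s : (∀ p, M.obj.obj (t.Y p)) × (∀ b, M.obj.obj (t.x b))) : Prop :=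
  (∀ p, s.1 p ∈ N (t.Y p)) ∧ ∀ p, k p - s.1 p = M.eval s.2 _ (t.coeff p)

/-- The value of a term. -/
noncomputable def Term.val {α : Cardinal.{u}} {M : CMod C} (N : ∀ X, Set (M.obj.obj X))
    (c : ∀ X, M.obj.obj X) : ∀ {X : Cᵒᵖ}, Term C α X → M.obj.obj X
  | _, const X => c X
  | _, zero X => 0
  | _, add g h => g.val N c + h.val N c
  | _, neg g => -g.val N c
  | _, map f g => (M.obj.map f).hom (g.val N c)
  | _, shift t k p => (Classical.epsilon (IsShiftedSol N t fun p => (k p).val N c)).1 p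
  | _, sol t k b => (Classical.epsilon (IsShiftedSol N t fun p => (k p).val N c)).2 b

/-- A family of elements indexed by terms that is compatible with the module operations. -/
structure IsTermHom {α : Cardinal.{u}} {M : CMod C} (σ : ∀ X, Term C α X → M.obj.obj X) :
    Prop where
  zero (X) : σ X (.zero X) = 0
  add {X} (g h : Term C α X) : σ X (.add g h) = σ X g + σ X h
  neg {X} (g : Term C α X) : σ X (.neg g) = -σ X g
  map {X Y} (f : X ⟶ Y) (g : Term C α X) : σ Y (.map f g) = (M.obj.map f).hom (σ X g)

lemma Term.isTermHom_val {α : Cardinal.{u}} {M : CMod C} (N : ∀ X, Set (M.obj.obj X))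
    (c : ∀ X, M.obj.obj X) : IsTermHom (α := α) fun _ g => g.val N c := by
  constructor <;> intros <;> rw [Term.val]

lemma Term.isShiftedSol_val {α : Cardinal.{u}} {M : CMod C} (N : ∀ X, Set (M.obj.obj X))
    (c : ∀ X, M.obj.obj X) (t : LinSystem C α) (k : ∀ p, Term C α (t.Y p))
    (h : ∃ s, IsShiftedSol N t (fun p => (k p).val N c) s) :
    IsShiftedSol N t (fun p => (k p).val N c)
      (fun p => (shift t k p).val N c, fun b => (sol t k b).val N c) := by
  have := Classical.epsilon_spec h
  simpa only [Term.val] using this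

/-- Linear combinations of terms are terms. -/
lemma exists_term_eval (α : Cardinal.{u}) {I : Type u} {x : I → Cᵒᵖ} (y : ∀ b, Term C α (x b))
    (Y : Cᵒᵖ) (c : Π₀ b, (x b ⟶ Y)) :
    ∃ g : Term C α Y, ∀ (M : CMod C) (σ : ∀ X, Term C α X → M.obj.obj X), IsTermHom σ →
      σ Y g = M.eval (fun b => σ _ (y b)) Y c := by
  classical
  induction c using DFinsupp.induction with
  | h0 => exact ⟨.zero Y, fun M σ h => by rw [h.zero, map_zero]⟩
  | ha b f c _ _ ih =>
    obtain ⟨g, hg⟩ := ih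
    exact ⟨.add (.map f (y b)) g, fun M σ h => by
      rw [h.add, h.map, hg M σ h, map_add, eval_single]⟩

/-! ### The hull, whose language depends only on `C`, `α` and `lam` -/

variable (C) in
/-- The data of a family of elements indexed by terms that are to be realized: the set of terms
whose values are prescribed, the equalities between the values, and the residue classes. -/
structure TermType (α lam : Cardinal.{u}) : Type u where
  /-- the set of terms whose values are prescribed -/
  fixed (X : Cᵒᵖ) : Set (Term C α X)
  /-- the equalities between the values -/
  rel (X : Cᵒᵖ) (g h : Term C α X) : Prop
  /-- the residue classes of the values -/
  res (X : Cᵒᵖ) (g : Term C α X) : lam.out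

variable (C) in
/-- The terms of the iterated operation of realizing families of elements indexed by terms. -/
inductive HullTerm (α lam : Cardinal.{u}) : Cᵒᵖ → Type u
  | zero (X : Cᵒᵖ) : HullTerm α lam X
  | real (τ : TermType C α lam) (v : ∀ X, Term C α X → HullTerm α lam X) {X : Cᵒᵖ}
      (g : Term C α X) : HullTerm α lam X

/-- The family `σ` has the given equalities and residue classes, and extends `v`. -/
structure Realizes {α lam : Cardinal.{u}} {M : CMod C} (q : ∀ X, M.obj.obj X → lam.out)
    (τ : TermType C α lam) (v σ : ∀ X, Term C α X → M.obj.obj X) : Prop where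
  isTermHom : IsTermHom σ
  eq_of_fixed {X} (g : Term C α X) : g ∈ τ.fixed X → σ X g = v X g
  eq_of_rel {X} (g h : Term C α X) : τ.rel X g h → σ X g = σ X h
  res_eq {X} (g : Term C α X) : q X (σ X g) = τ.res X g

/-- The value of a term of the hull. -/
noncomputable def HullTerm.val {α lam : Cardinal.{u}} {M : CMod C}
    (q : ∀ X, M.obj.obj X → lam.out) : ∀ {X : Cᵒᵖ}, HullTerm C α lam X → M.obj.obj X
  | _, zero X => 0
  | _, real τ v g => Classical.epsilon (Realizes q τ fun X h => (v X h).val q) _ g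

/-- The set of the values of the terms of the hull. -/
def hull (α : Cardinal.{u}) {lam : Cardinal.{u}} {M : CMod C} (q : ∀ X, M.obj.obj X → lam.out)
    (X : Cᵒᵖ) : Set (M.obj.obj X) :=
  Set.range fun g : HullTerm C α lam X => g.val q

/-- Every family of elements indexed by terms has a copy in the hull, with the same residue classes,
that agrees with the family where the family lies in the hull. -/
lemma exists_hull_copy (α : Cardinal.{u}) {lam : Cardinal.{u}} {M : CMod C}
    (q : ∀ X, M.obj.obj X → lam.out) {σ : ∀ X, Term C α X → M.obj.obj X} (hσ : IsTermHom σ) :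
    ∃ σ' : ∀ X, Term C α X → M.obj.obj X, IsTermHom σ' ∧
      (∀ X g, σ' X g ∈ hull α q X) ∧ (∀ X g, σ X g ∈ hull α q X → σ' X g = σ X g) ∧
      (∀ X g h, σ X g = σ X h → σ' X g = σ' X h) ∧ ∀ X g, q X (σ' X g) = q X (σ X g) := by
  let τ : TermType C α lam :=
    { fixed := fun X => {g | σ X g ∈ hull α q X}
      rel := fun X g h => σ X g = σ X h
      res := fun X g => q X (σ X g) }
  have hv (X) (g : Term C α X) :
      ∃ t : HullTerm C α lam X, σ X g ∈ hull α q X → t.val q = σ X g := by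
    by_cases h : σ X g ∈ hull α q X
    · obtain ⟨t, ht⟩ := h
      exact ⟨t, fun _ => ht⟩
    -- Outside the hull nothing is prescribed, so any term serves.
    · exact ⟨.zero X, fun h' => absurd h' h⟩
  choose v hv using hv
  have hreal : Realizes q τ (fun X h => (v X h).val q) σ :=
    ⟨hσ, fun g hg => (hv _ g hg).symm, fun _ _ h => h, fun _ => rfl⟩
  have h := Classical.epsilon_spec (p := Realizes q τ fun X h => (v X h).val q) ⟨σ, hreal⟩
  refine ⟨_, h.isTermHom, fun X g => ⟨.real τ v g, rfl⟩, fun X g hg => ?_,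
    fun X g g' => h.eq_of_rel g g', fun X g => h.res_eq g⟩
  exact (h.eq_of_fixed g hg).trans (hv X g hg)

/-! ### The module of differences -/

/-- The differences of a compatible family of elements and a compatible copy of it. -/
def diffSub {α : Cardinal.{u}} {M : CMod C} {σ σ' : ∀ X, Term C α X → M.obj.obj X}
    (hσ : IsTermHom σ) (hσ' : IsTermHom σ') : Sub M where
  carrier X :=
    { carrier := Set.range fun g => σ X g - σ' X g
      zero_mem' := ⟨.zero X, by simp only [hσ.zero, hσ'.zero, sub_zero]⟩
      add_mem' := by
        rintro _ _ ⟨g, rfl⟩ ⟨h, rfl⟩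
        exact ⟨.add g h, by simp only [hσ.add, hσ'.add]; abel⟩
      neg_mem' := by
        rintro _ ⟨g, rfl⟩
        exact ⟨.neg g, by simp only [hσ.neg, hσ'.neg]; abel⟩ }
  map_mem := by
    rintro X Y f _ ⟨g, rfl⟩
    exact ⟨.map f g, by simp only [hσ.map, hσ'.map, map_sub]⟩

/-- The differences of the values of terms and a copy of them in `N` form an `α`-pure submodule. -/
theorem isPureMono_diffSub {α : Cardinal.{u}} [Fact α.IsRegular] {M : CMod C}
    (N : ∀ X, Set (M.obj.obj X)) (c : ∀ X, M.obj.obj X)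
    {σ' : ∀ X, Term C α X → M.obj.obj X} (hσ' : IsTermHom σ') (hN : ∀ X g, σ' X g ∈ N X)
    (hfix : ∀ X (g : Term C α X), g.val N c ∈ N X → σ' X g = g.val N c)
    (hrel : ∀ X (g h : Term C α X), g.val N c = h.val N c → σ' X g = σ' X h) :
    IsPureMono α (diffSub (Term.isTermHom_val N c) hσ').ι := by
  refine Sub.isPureMono_ι _ fun t k y hk hy => ?_
  choose g hg using hk
  simp only at hg
  -- The copies `σ' (g p)` lie in `N` and are an admissible translation, with solution `y`.
  have hs := Term.isShiftedSol_val N c t g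
    ⟨(fun p => σ' _ (g p), y), fun p => hN _ _, fun p => (hg p).trans (hy p)⟩
  refine ⟨fun b => (Term.sol t g b).val N c - σ' _ (.sol t g b), fun b => ⟨_, rfl⟩, fun p => ?_⟩
  obtain ⟨e, he⟩ := exists_term_eval α (fun b => Term.sol t g b) (t.Y p) (t.coeff p)
  have h1 := he M _ (Term.isTermHom_val N c)
  -- The solved equation is an equality between values of terms, so it passes to `σ'`; the shift is
  -- then fixed because it lies in `N`.
  have h2 := hrel _ (g p) (.add (.shift t g p) e) (by
    rw [Term.val]
    refine (sub_eq_iff_eq_add'.1 (hs.2 p)).trans ?_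
    exact congrArg _ h1.symm)
  rw [hσ'.add, hfix _ (.shift t g p) (hs.1 p), he M _ hσ'] at h2
  rw [eval_sub, ← hg, h2, ← hs.2 p]
  abel

/-! ### Cardinalities and the conclusion -/

lemma mk_obj_le_card (M : CMod C) (X : Cᵒᵖ) : Cardinal.mk (M.obj.obj X) ≤ M.card := by
  let Y : Skeleton C := toSkeleton X.unop
  have e : op ((fromSkeleton C).obj Y) ≅ X := (fromSkeletonToSkeletonIso X.unop).symm.op
  have e' : M.obj.obj (op ((fromSkeleton C).obj Y)) ≃ M.obj.obj X :=
    (M.obj.mapIso e).addCommGroupIsoToAddEquiv.toEquiv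
  rw [← Cardinal.mk_congr e']
  exact Cardinal.le_sum (fun X : Skeleton C =>
    Cardinal.mk (M.obj.obj (op ((fromSkeleton C).obj X)))) Y

lemma card_le_mk_sigma (M : CMod C) : M.card ≤ Cardinal.mk (Σ X : Cᵒᵖ, M.obj.obj X) := by
  rw [card, ← Cardinal.mk_sigma]
  have hinj : Function.Injective fun X : Skeleton C => op ((fromSkeleton C).obj X) :=
    op_injective.comp Quotient.out_injective
  exact Cardinal.mk_le_of_injective (hinj.sigma_map fun _ => Function.injective_id)

end CMod

theorem corollary5p3 {C : Type u} [SmallCategory C] [Preadditive C]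
    (α : Cardinal.{u}) [Fact α.IsRegular] (lam : Cardinal.{u}) :
    ∃ κ : Cardinal.{u}, ∀ (M : CMod C) (L : CMod.Sub M),
      κ ≤ M.card → L.quotient.card ≤ lam →
        ∃ K : CMod.Sub M, K ≤ L ∧ K ≠ ⊥ ∧ CMod.IsPureMono α K.ι := by
  classical
  refine ⟨Order.succ (Cardinal.mk (Σ X, CMod.HullTerm C α lam X)), fun M L hM hL => ?_⟩
  have hemb (X : Cᵒᵖ) : Nonempty (L.quotient.obj.obj X ↪ lam.out) := by
    rw [← Cardinal.le_def, Cardinal.mk_out]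
    exact (L.quotient.mk_obj_le_card X).trans hL
  let j (X : Cᵒᵖ) := (hemb X).some
  let q (X : Cᵒᵖ) (m : M.obj.obj X) : lam.out := j X ((L.proj.hom.app X).hom m)
  -- Otherwise hull terms would map onto all elements of `M`, against the choice of `κ`.
  obtain ⟨X₀, m₀, hm₀⟩ : ∃ X m, m ∉ CMod.hull α q X := by
    by_contra! h
    refine (Order.succ_le_iff.1 (hM.trans M.card_le_mk_sigma)).not_ge ?_
    refine Cardinal.mk_le_of_surjective
      (f := fun a : Σ X, CMod.HullTerm C α lam X => (⟨a.1, a.2.val q⟩ : Σ X, M.obj.obj X)) ?_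
    rintro ⟨X, m⟩
    obtain ⟨g, rfl⟩ := h X m
    exact ⟨⟨X, g⟩, rfl⟩
  let N := CMod.hull α q
  let c : ∀ X, M.obj.obj X := Function.update (fun _ => 0) X₀ m₀
  obtain ⟨σ', hσ', hN, hfix, hrel, hres⟩ :=
    CMod.exists_hull_copy α q (CMod.Term.isTermHom_val N c)
  refine ⟨CMod.diffSub (CMod.Term.isTermHom_val N c) hσ', ?_, ?_,
    CMod.isPureMono_diffSub N c hσ' hN hfix hrel⟩
  · rintro X _ ⟨g, rfl⟩
    -- Equal residues mean equal classes in `M / L`, since `j X` is injective.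
    exact L.proj_eq_iff.1 ((j X).injective (hres X g)).symm
  · intro h
    have hmem : (CMod.Term.const X₀ : CMod.Term C α X₀).val N c - σ' X₀ (.const X₀) ∈
        (⊥ : CMod.Sub M).carrier X₀ := h ▸ ⟨_, rfl⟩
    have heq := sub_eq_zero.1 (AddSubgroup.mem_bot.1 hmem)
    rw [CMod.Term.val] at heq
    simp only [c, Function.update_self] at heq
    exact hm₀ (heq ▸ hN X₀ _)
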